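/- **Theorem.** Let $m_a,m_s,m_b,\mathcal I_a,\mathcal I_b,L,d_G,g,T_{max}>0$ and put $M_t=m_s+m_b+m_a$, $M_a=\frac{m_bd_G}{L}+m_a$, $\mathcal I_0=\frac{m_bd_G^2+\mathcal I_b}{L}+m_aL$. Consider the system with coordinates $q=(x,\alpha)$ (position and inclination of the object) and $\beta$ (attitude of the UAV) $$M(q)\ddot q+C(q,\dot q)\dot q+g(q)=\begin{pmatrix}u_{ff}\\ u_n\sin(\beta-\alpha)\end{pmatrix},\qquad \mathcal I_a\ddot\beta=u_2,$$ $$M(q)=\begin{pmatrix}M_t&-M_aL\sin\alpha\\-M_aL\sin\alpha&\mathcal I_0L\end{pmatrix},\quad C(q,\dot q)=\begin{pmatrix}0&-M_aL\dot\alpha\cos\alpha\\0&0\end{pmatrix},\quad g(q)=\begin{pmatrix}0\\M_aLg\cos\alpha\end{pmatrix}.$$ Let $x_d\in\mathbb R$ and $\alpha_d\in(\alpha_{min},\alpha_{max})$, where $\alpha_{min}=\arccos\frac{T_{max}}{M_ag}$ and $\alpha_{max}=\arccos\frac{-T_{max}}{M_ag}$ if $T_{max}<M_ag$, and $\alpha_{min}=0$,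 $\alpha_{max}=\pi$ if $T_{max}\ge M_ag$. Let $k_{p,x}>k_{p,\alpha}>0$, $k_{v,x}>k_{v,\alpha}>0$, $\epsilon>0$, $\gamma=\frac{\pi}{2\arctan(\epsilon T_{max}L)}$, and let the system be controlled by $$u_{ff}=k_{p,x}(x_d-x)-k_{v,x}\dot x,\qquad u_2=-k_{p,\beta}\,(\beta-\alpha-\theta_d)-k_{v,\beta}\,\dot\beta,\qquad u_n=\frac{f_t}{\sin\theta_d},$$ $$f_t=k_{p,\alpha}(\alpha_d-\alpha)-k_{v,\alpha}\dot\alpha+M_aLg\cos\alpha,\qquad \theta_d=\sigma_{\pi/2}\big(\gamma\arctan(\epsilon f_t)\big),$$ where $\sigma_\lambda(y)=\mathrm{sign}(y)\min(|y|,\lambda)$ and $u_n$ is extended continuously by $u_n=\frac1{\gamma\epsilon}$ at $f_t=0$. Let $\beta_d=\alpha_d+\sigma_{\pi/2}\big(\gamma\arctan(\epsilon M_aLg\cos\alpha_d)\big)$ be the resulting steady-state attitude. Then the equilibrium $(x,\alpha,\beta)=(x_d,\alpha_d,\beta_d)$, with zero velocities, of the closed loop is (locally) asymptotically stable for suitably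 large attitude gains, in the following sense: there is $K>0$ such that it is asymptotically stable whenever $k_{v,\beta}\ge K$ and $k_{p,\beta}\ge K\,k_{v,\beta}$. -/

import Mathlib

open Filter Topology Matrix

noncomputable section

section Stability

variable {E : Type*} [NormedAddCommGroup E] [NormedSpace ℝ E]

/-- `z` solves, on the time interval `J`, the autonomous differential equation given in implicit
form by the relation `R` between the state and its velocity (one-sided derivatives at endpoints
of `J`). -/
def IsSolutionOn (R : E → E → Prop) (z : ℝ → E) (J : Set ℝ) : Prop :=
  ∀ t ∈ J, ∃ v : E, HasDerivWithinAt z v J t ∧ R (z t) v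

/-- (Local) asymptotic stability of the point `z₀` for the autonomous differential equation `R`:
`z₀` is an equilibrium, it is Lyapunov stable, and, for all initial states close enough to `z₀`,
solutions exist for all positive times and all of them converge to `z₀`. -/
structure IsAsymptoticallyStable (R : E → E → Prop) (z₀ : E) : Prop where
  equilibrium : R z₀ 0
  stable : ∀ r > 0, ∃ δ > 0, ∀ (T : ℝ) (z : ℝ → E), IsSolutionOn R z (Set.Ico 0 T) →
    ‖z 0 - z₀‖ < δ → ∀ t ∈ Set.Ico 0 T, ‖z t - z₀‖ < r
  attractive : ∃ δ > 0,
    (∀ w : E, ‖w - z₀‖ < δ → ∃ z : ℝ → E, z 0 = w ∧ IsSolutionOn R z (Set.Ici 0)) ∧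
    (∀ z : ℝ → E, IsSolutionOn R z (Set.Ici 0) → ‖z 0 - z₀‖ < δ → Tendsto z atTop (𝓝 z₀))

end Stability

namespace UavUgv

/-- Physical parameters: masses of the UAV, the UGV and the object, moments of inertia of the UAV
and the object, length of the object, distance from the UGV to the center of mass of the object,
gravity acceleration, and maximal thrust of the UAV. -/
structure Plant where
  m_a : ℝ
  m_s : ℝ
  m_b : ℝ
  I_a : ℝ
  I_b : ℝ
  L : ℝ
  d_G : ℝ
  g : ℝ
  T_max : ℝ
  m_a_pos : 0 < m_a
  m_s_pos : 0 < m_s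
  m_b_pos : 0 < m_b
  I_a_pos : 0 < I_a
  I_b_pos : 0 < I_b
  L_pos : 0 < L
  d_G_pos : 0 < d_G
  g_pos : 0 < g
  T_max_pos : 0 < T_max

/-- Gains of the UGV law and of the outer loop of the UAV law, and the parameter `ε` of the
arctan mapping. -/
structure Gains where
  kp_x : ℝ
  kv_x : ℝ
  kp_α : ℝ
  kv_α : ℝ
  ε : ℝ
  kp_x_pos : 0 < kp_x
  kv_x_pos : 0 < kv_x
  kp_α_pos : 0 < kp_α
  kv_α_pos : 0 < kv_α
  ε_pos : 0 < ε
  kp_lt : kp_α < kp_x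
  kv_lt : kv_α < kv_x

namespace Plant

variable (p : Plant)

/-- Total mass `M_t`. -/
def totalMass : ℝ := p.m_s + p.m_b + p.m_a

/-- Apparent mass `M_a` of the UAV and the object. -/
def apparentMass : ℝ := p.m_b * p.d_G / p.L + p.m_a

/-- Moment of inertia divided by the length, `I_0`. -/
def inertia : ℝ := (p.m_b * p.d_G ^ 2 + p.I_b) / p.L + p.m_a * p.L

/-- Inertia matrix `M(q)`, `q = (x, α)`. -/
def massMatrix (α : ℝ) : Matrix (Fin 2) (Fin 2) ℝ :=
  !![p.totalMass, -(p.apparentMass * p.L * Real.sin α);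
     -(p.apparentMass * p.L * Real.sin α), p.inertia * p.L]

/-- Coriolis matrix `C(q, q')`. -/
def coriolisMatrix (α dα : ℝ) : Matrix (Fin 2) (Fin 2) ℝ :=
  !![0, -(p.apparentMass * p.L * dα * Real.cos α);
     0, 0]

/-- Gravity vector `g(q)`. -/
def gravityVector (α : ℝ) : Fin 2 → ℝ :=
  ![0, p.apparentMass * p.L * p.g * Real.cos α]

/-- Lower end of the range of attainable inclinations; all of `[0, π]` is attainable when
`T_max ≥ M_a g`. -/
def alphaMin : ℝ :=
  if p.T_max < p.apparentMass * p.g then Real.arccos (p.T_max / (p.apparentMass * p.g)) else 0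

/-- Upper end of the range of attainable inclinations. -/
def alphaMax : ℝ :=
  if p.T_max < p.apparentMass * p.g then Real.arccos (-p.T_max / (p.apparentMass * p.g))
  else Real.pi

end Plant

/-- Saturation function `σ_b(y) = sign(y) min(|y|, b)`. -/
def sat (b y : ℝ) : ℝ := Real.sign y * min |y| b

variable (p : Plant) (k : Gains)

/-- The parameter `γ` of the arctan mapping, fixed so that `θ_d = π/2` for `f_t = T_max L`. -/
def gammaPar : ℝ := Real.pi / (2 * Real.arctan (k.ε * (p.T_max * p.L)))

/-- Tangential force requested by the PD law with gravity compensation. -/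
def tangentialForce (α_d α dα : ℝ) : ℝ :=
  k.kp_α * (α_d - α) - k.kv_α * dα + p.apparentMass * p.L * p.g * Real.cos α

/-- Desired relative attitude `θ_d` as a function of the tangential force. -/
def thetaD (f : ℝ) : ℝ := sat (Real.pi / 2) (gammaPar p k * Real.arctan (k.ε * f))

/-- Normalized thrust `u_n = f_t / sin θ_d`, extended continuously at `f_t = 0` by its limit
`1 / (γ ε)` (for `f_t ≠ 0` the denominator does not vanish). -/
def normalizedThrust (f : ℝ) : ℝ :=
  if f = 0 then 1 / (gammaPar p k * k.ε) else f / Real.sin (thetaD p k f)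

/-- Desired attitude `β_d = α + θ_d` computed by the outer loop. -/
def betaD (α_d α dα : ℝ) : ℝ := α + thetaD p k (tangentialForce p k α_d α dα)

/-- Closed loop as a relation between the state `z = (x, α, β, x', α', β')` and its velocity `v`:
the manipulator `M(q) q'' + C(q, q') q' + g(q) = τ` with `τ = (u_ff, u_n sin (β - α))`, and the
attitude dynamics `I_a β'' = u_2`, under the feedback laws for `u_ff`, `u_n` and `u_2`. -/
def closedLoop (kp_β kv_β x_d α_d : ℝ) (z v : Fin 6 → ℝ) : Prop :=
  let x := z 0
  let α := z 1
  let β := z 2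
  let dx := z 3
  let dα := z 4
  let dβ := z 5
  let u_ff := k.kp_x * (x_d - x) - k.kv_x * dx
  let u_n := normalizedThrust p k (tangentialForce p k α_d α dα)
  let u_2 := kp_β * (betaD p k α_d α dα - β) - kv_β * dβ
  v 0 = dx ∧ v 1 = dα ∧ v 2 = dβ ∧
  p.massMatrix α *ᵥ ![v 3, v 4] + p.coriolisMatrix α dα *ᵥ ![dx, dα] + p.gravityVector α
    = ![u_ff, u_n * Real.sin (β - α)] ∧
  p.I_a * v 5 = u_2

/-- The steady-state attitude resulting from the desired inclination `α_d`. -/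
def steadyBeta (α_d : ℝ) : ℝ := betaD p k α_d α_d 0

/-- The state at rest in the configuration `(x_d, α_d, β_d)`. -/
def equilibriumState (x_d α_d : ℝ) : Fin 6 → ℝ :=
  ![x_d, α_d, steadyBeta p k α_d, 0, 0, 0]

end UavUgv

end

/-!
The closed loop can be solved for the velocity of the state, because the inertia matrix is positive
definite (`UavUgv.closedLoop_iff`); so it is an ordinary differential equation. At an attainable
inclination gravity asks for less than the maximal thrust, hence near the equilibrium the attitude
command is not saturated, and the vector field is `C¹`
(`UavUgv.contDiffAt_closedLoopField`); the only delicate point is the normalized thrust at `f_t = 0`,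
where it is the inverse of a difference quotient of an analytic function.

Stability is then decided by the linearization (`isAsymptoticallyStable_of_quadratic`): it is enough
to find a positive definite quadratic form that decreases strictly along the linear system. Solutions
starting close to the equilibrium stay in a sublevel set of the form, where it decays exponentially;
they exist for all times since they also solve a bounded, globally Lipschitz equation.

In the linearized loop (`UavUgv.linearization_closedLoopField`) the slow variables `x`, `α` form a
mechanical system with stiffness `diag (kp_x, kp_α)` and damping `diag (kv_x, kv_α)`, disturbed only
through the error `b` between the attitude and its command: since `u_n sin θ_d = f_t` holds
identically, the linearized tangential force is the PD law plus `c₀ b`. The attitude loop is a damped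
oscillator `I b'' + kv b' + kp b = …` driven by the motion of the command, whose rate is bounded by
the slow state and `b`, independently of the attitude gains. The Lyapunov form is the sum of `kp`
times the slow energy with a small cross term and the attitude energy with a cross term of weight `μ`
(`lyapunovForm`). First `μ` is chosen large against the coupling constants, then `K` large against
`μ`; this order makes the estimate uniform over all gains with `K ≤ kv` and `K * kv ≤ kp`
(`exists_gain_bound`, `exists_lyapunovForm`).
-/

noncomputable section

/-! ### Global solutions of bounded Lipschitz equations -/

section GlobalExistence

variable {E : Type*} [NormedAddCommGroup E] [NormedSpace ℝ E]

theorem IsSolutionOn.mono {R : E → E → Prop} {z : ℝ → E} {J J' : Set ℝ}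
    (h : IsSolutionOn R z J) (hJ : J' ⊆ J) : IsSolutionOn R z J' := fun t ht ↦ by
  obtain ⟨v, hv, hR⟩ := h t (hJ ht)
  exact ⟨v, hv.mono hJ, hR⟩

/-- A bounded Lipschitz autonomous vector field has a forward solution on every interval `[0, n]`;
by uniqueness these solutions fit together to one defined for all positive times. -/
theorem exists_isSolutionOn_Ici [CompleteSpace E] {G : E → E} {K L : NNReal}
    (hG : LipschitzWith K G) (hL : ∀ x, ‖G x‖ ≤ L) (w : E) :
    ∃ z : ℝ → E, z 0 = w ∧ IsSolutionOn (fun x v ↦ v = G x) z (Set.Ici 0) := by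
  have loc (n : ℕ) : ∃ z : ℝ → E, z 0 = w ∧
      ∀ t ∈ Set.Icc (0 : ℝ) n, HasDerivWithinAt z (G (z t)) (Set.Icc (0 : ℝ) n) t := by
    have hPL : IsPicardLindelof (fun _ ↦ G) (tmin := 0) (tmax := (n : ℝ))
        ⟨0, le_rfl, n.cast_nonneg⟩ w (L * n) 0 L K :=
      { lipschitzOnWith := fun t _ ↦ hG.lipschitzOnWith
        continuousOn := fun x _ ↦ continuousOn_const
        norm_le := fun t _ x _ ↦ hL x
        mul_max_le := by simp }
    exact hPL.exists_eq_forall_mem_Icc_hasDerivWithinAt₀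
  choose y hy0 hy using loc
  have right (n : ℕ) (t : ℝ) (ht : t ∈ Set.Ico (0 : ℝ) n) :
      HasDerivWithinAt (y n) (G (y n t)) (Set.Ici t) t :=
    (hy n t ⟨ht.1, ht.2.le⟩).mono_of_mem_nhdsWithin <|
      mem_of_superset (Icc_mem_nhdsGE ht.2) (Set.Icc_subset_Icc_left ht.1)
  have agree {m n : ℕ} (hmn : m ≤ n) : Set.EqOn (y m) (y n) (Set.Icc (0 : ℝ) m) := by
    have hmn' : (m : ℝ) ≤ n := by exact_mod_cast hmn
    refine ODE_solution_unique (v := fun _ ↦ G) (fun _ ↦ hG)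
      (fun t ht ↦ (hy m t ht).continuousWithinAt) (fun t ht ↦ right m t ht)
      (fun t ht ↦ ((hy n t ⟨ht.1, ht.2.trans hmn'⟩).continuousWithinAt).mono
        (Set.Icc_subset_Icc_right hmn'))
      (fun t ht ↦ right n t ⟨ht.1, ht.2.trans_le hmn'⟩) ((hy0 m).trans (hy0 n).symm)
  have glue {n : ℕ} {t : ℝ} (ht : t ∈ Set.Icc (0 : ℝ) n) : y ⌈t⌉₊ t = y n t :=
    agree (Nat.ceil_le.2 ht.2) ⟨ht.1, Nat.le_ceil t⟩
  refine ⟨fun t ↦ y ⌈t⌉₊ t, by simpa using hy0 0, fun t ht ↦ ⟨_, ?_, rfl⟩⟩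
  obtain ⟨n, hn⟩ := exists_nat_gt t
  have hd := (hy n t ⟨ht, hn.le⟩).congr (f₁ := fun t ↦ y ⌈t⌉₊ t) (fun s hs ↦ glue hs)
    (glue ⟨ht, hn.le⟩)
  rw [← glue ⟨ht, hn.le⟩] at hd
  refine hd.mono_of_mem_nhdsWithin ?_
  rw [← Set.Ici_inter_Iic, Set.inter_comm]
  exact inter_mem (mem_nhdsWithin_of_mem_nhds (Iic_mem_nhds hn)) self_mem_nhdsWithin

end GlobalExistence

/-! ### Quadratic Lyapunov functions -/

section Lyapunov

variable {E : Type*} [NormedAddCommGroup E] [NormedSpace ℝ E]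

/-- A continuous function that is homogeneous of degree two and positive away from the origin of a
finite-dimensional space is bounded below by a positive multiple of the squared norm. -/
theorem exists_pos_mul_sq_norm_le [FiniteDimensional ℝ E] {Q : E → ℝ} (hQ : Continuous Q)
    (hhom : ∀ (c : ℝ) (h : E), Q (c • h) = c ^ 2 * Q h) (hpos : ∀ h ≠ 0, 0 < Q h) :
    ∃ c > 0, ∀ h, c * ‖h‖ ^ 2 ≤ Q h := by
  have hQ0 : Q 0 = 0 := by simpa using hhom 0 0
  rcases subsingleton_or_nontrivial E with hE | hE
  · exact ⟨1, one_pos, fun h ↦ by simp [Subsingleton.elim h 0, hQ0]⟩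
  obtain ⟨u, hu, hmin⟩ := (isCompact_sphere (0 : E) 1).exists_isMinOn
    (NormedSpace.sphere_nonempty.2 zero_le_one) hQ.continuousOn
  have hu0 : u ≠ 0 := by
    rintro rfl
    simp at hu
  refine ⟨Q u, hpos u hu0, fun h ↦ ?_⟩
  rcases eq_or_ne h 0 with rfl | hh
  · simp [hQ0]
  have hn : ‖h‖ ≠ 0 := norm_ne_zero_iff.2 hh
  have hm : Q u ≤ Q (‖h‖⁻¹ • h) := hmin (by simp [norm_smul, hn])
  rw [hhom] at hm
  calc Q u * ‖h‖ ^ 2 ≤ ‖h‖⁻¹ ^ 2 * Q h * ‖h‖ ^ 2 := by gcongr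
    _ = Q h := by field_simp

/-- Exponential decay of a quadratic form `B` along a solution, as long as the form decreases at the
rate `lam` on the ball of radius `r` and starts below a level `κ` whose sublevel set lies in that
ball. -/
theorem IsSolutionOn.quadratic_le_exp {G : E → E} {z₀ : E} {B : E →L[ℝ] E →L[ℝ] ℝ}
    {c r lam κ T : ℝ} (hc : 0 < c) (hr : 0 < r) (hlam : 0 < lam)
    (hB : ∀ h, c * ‖h‖ ^ 2 ≤ B h h)
    (hdec : ∀ h, ‖h‖ ≤ r → B h (G (z₀ + h)) + B (G (z₀ + h)) h ≤ -lam * B h h)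
    (hκ : 0 < κ) (hκr : κ ≤ c * r ^ 2) {z : ℝ → E}
    (hz : IsSolutionOn (fun x v ↦ v = G x) z (Set.Ico 0 T)) (h0 : B (z 0 - z₀) (z 0 - z₀) ≤ κ)
    {t : ℝ} (ht : t ∈ Set.Ico 0 T) :
    B (z t - z₀) (z t - z₀) ≤ κ * Real.exp (-(lam / 2) * t) := by
  have hz' : ∀ s ∈ Set.Ico 0 T, HasDerivWithinAt z (G (z s)) (Set.Ico 0 T) s := fun s hs ↦ by
    obtain ⟨v, hv, rfl⟩ := hz s hs
    exact hv
  have hV (s : ℝ) (hs : s ∈ Set.Ico 0 T) :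
      HasDerivWithinAt (fun s ↦ B (z s - z₀) (z s - z₀))
        (B (z s - z₀) (G (z s)) + B (G (z s)) (z s - z₀)) (Set.Ico 0 T) s := by
    have hd := (hz' s hs).sub_const z₀
    have := (B.hasFDerivAt.comp_hasDerivWithinAt s hd).clm_apply hd
    simpa [add_comm] using this
  have hsub : Set.Icc 0 t ⊆ Set.Ico 0 T := fun s hs ↦ ⟨hs.1, hs.2.trans_lt ht.2⟩
  refine image_le_of_deriv_right_lt_deriv_boundary
    (B := fun s ↦ κ * Real.exp (-(lam / 2) * s))
    (B' := fun s ↦ κ * (Real.exp (-(lam / 2) * s) * -(lam / 2)))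
    (fun s hs ↦ (hV s (hsub hs)).continuousWithinAt.mono hsub)
    (fun s hs ↦ (hV s (hsub ⟨hs.1, hs.2.le⟩)).mono_of_mem_nhdsWithin ?_) (by simpa using h0)
    (fun s ↦ ?_) (fun s hs heq ↦ ?_) ⟨ht.1, le_rfl⟩
  · exact mem_of_superset (Ico_mem_nhdsGE (hs.2.trans ht.2)) (Set.Ico_subset_Ico_left hs.1)
  · simpa using (((hasDerivAt_id s).const_mul (-(lam / 2))).exp).const_mul κ
  · set h := z s - z₀ with hh
    have hexp : Real.exp (-(lam / 2) * s) ≤ 1 := Real.exp_le_one_iff.2 (by nlinarith [hs.1])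
    have hpos : 0 < κ * Real.exp (-(lam / 2) * s) := by positivity
    have hle : B h h ≤ κ := heq.trans_le (mul_le_of_le_one_right hκ.le hexp)
    have hball : ‖h‖ ≤ r := by
      have : ‖h‖ ^ 2 ≤ r ^ 2 := le_of_mul_le_mul_left ((hB h).trans (hle.trans hκr)) hc
      exact (sq_le_sq₀ (norm_nonneg _) hr.le).1 this
    have hd := hdec h hball
    rw [show z₀ + h = z s by simp [hh], heq] at hd
    nlinarith

/-- Near an equilibrium `z₀` of a vector field with derivative `A` there, a quadratic form that
decreases strictly along the linearization `A` also decreases along the field, at a definite rate. -/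
theorem exists_quadratic_decrease [FiniteDimensional ℝ E] {F : E → E} {z₀ : E} {A : E →L[ℝ] E}
    (hA : HasFDerivAt F A z₀) (h0 : F z₀ = 0) (B : E →L[ℝ] E →L[ℝ] ℝ)
    (hneg : ∀ h ≠ 0, B h (A h) + B (A h) h < 0) :
    ∃ lam > 0, ∃ r > 0, ∀ h, ‖h‖ ≤ r → B h (F (z₀ + h)) + B (F (z₀ + h)) h ≤ -lam * B h h := by
  obtain ⟨c, hc, hcA⟩ := exists_pos_mul_sq_norm_le (Q := fun h ↦ -(B h (A h) + B (A h) h))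
    (by fun_prop) (fun a h ↦ by simp; ring) (fun h hh ↦ neg_pos.2 (hneg h hh))
  have hb : 0 < ‖B‖ + 1 := by positivity
  have hε : 0 < c / (4 * (‖B‖ + 1)) := by positivity
  have hlin := (hasFDerivAt_iff_isLittleO_nhds_zero.1 hA).def hε
  obtain ⟨r, hr, hball⟩ := Metric.eventually_nhds_iff.1 hlin
  refine ⟨c / (2 * (‖B‖ + 1)), by positivity, r / 2, by positivity, fun h hh ↦ ?_⟩
  have herr := hball (y := h) (by rw [dist_zero_right]; linarith)
  rw [h0, sub_zero] at herr
  set e := F (z₀ + h) - A h with he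
  have hF : F (z₀ + h) = A h + e := by simp [he]
  have b1 : |B h e| ≤ ‖B‖ * ‖h‖ * ‖e‖ := B.le_opNorm₂ h e
  have b2 : |B e h| ≤ ‖B‖ * ‖e‖ * ‖h‖ := B.le_opNorm₂ e h
  have b3 : |B h h| ≤ ‖B‖ * ‖h‖ * ‖h‖ := B.le_opNorm₂ h h
  have hrate : c / (2 * (‖B‖ + 1)) * B h h ≤ c / 2 * ‖h‖ ^ 2 := by
    have : B h h ≤ (‖B‖ + 1) * ‖h‖ ^ 2 := by nlinarith [le_abs_self (B h h), sq_nonneg ‖h‖]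
    calc c / (2 * (‖B‖ + 1)) * B h h ≤ c / (2 * (‖B‖ + 1)) * ((‖B‖ + 1) * ‖h‖ ^ 2) := by gcongr
      _ = c / 2 * ‖h‖ ^ 2 := by field_simp
  have hpert : ‖B‖ * ‖h‖ * ‖e‖ ≤ c / 4 * ‖h‖ ^ 2 := by
    calc ‖B‖ * ‖h‖ * ‖e‖ ≤ (‖B‖ + 1) * ‖h‖ * (c / (4 * (‖B‖ + 1)) * ‖h‖) := by
          gcongr
          linarith
      _ = c / 4 * ‖h‖ ^ 2 := by field_simp
  have hA' := hcA h
  rw [hF]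
  simp only [map_add, _root_.add_apply]
  linarith [le_abs_self (B h e), le_abs_self (B e h), mul_right_comm ‖B‖ ‖e‖ ‖h‖]

/-- The nearest-point retraction of `ι → ℝ` onto the closed ball of radius `r` about `z₀`, which in
the supremum norm is a box. -/
def clampBox {ι : Type*} (z₀ : ι → ℝ) (r : ℝ) (x : ι → ℝ) : ι → ℝ :=
  fun i ↦ max (z₀ i - r) (min (z₀ i + r) (x i))

theorem lipschitzWith_clampBox {ι : Type*} [Fintype ι] (z₀ : ι → ℝ) (r : ℝ) :
    LipschitzWith 1 (clampBox z₀ r) := by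
  refine LipschitzWith.of_dist_le_mul fun x y ↦ (dist_pi_le_iff (by positivity)).2 fun i ↦ ?_
  have h := ((LipschitzWith.eval (α := fun _ : ι ↦ ℝ) i).const_min (z₀ i + r)).const_max (z₀ i - r)
  exact h.dist_le_mul x y

theorem clampBox_mem_closedBall {ι : Type*} [Fintype ι] (z₀ : ι → ℝ) {r : ℝ} (hr : 0 ≤ r)
    (x : ι → ℝ) : clampBox z₀ r x ∈ Metric.closedBall z₀ r := by
  refine (dist_pi_le_iff hr).2 fun i ↦ ?_
  rw [Real.dist_eq, abs_le, clampBox]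
  constructor
  · linarith [le_max_left (z₀ i - r) (min (z₀ i + r) (x i))]
  · have : max (z₀ i - r) (min (z₀ i + r) (x i)) ≤ z₀ i + r :=
      max_le (by linarith) (min_le_left _ _)
    linarith

theorem clampBox_eq_self {ι : Type*} [Fintype ι] {z₀ : ι → ℝ} {r : ℝ} {x : ι → ℝ}
    (hx : x ∈ Metric.closedBall z₀ r) : clampBox z₀ r x = x := by
  funext i
  have h := (dist_le_pi_dist x z₀ i).trans hx
  rw [Real.dist_eq, abs_le] at h
  rw [clampBox, min_eq_right (by linarith), max_eq_right (by linarith)]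

/-- **Lyapunov's indirect method**: an equilibrium of a `C¹` vector field is asymptotically stable
if the linearization there strictly decreases some positive definite quadratic form. -/
theorem isAsymptoticallyStable_of_quadratic {ι : Type*} [Fintype ι]
    {R : (ι → ℝ) → (ι → ℝ) → Prop} {F : (ι → ℝ) → ι → ℝ} {z₀ : ι → ℝ}
    {A : (ι → ℝ) →L[ℝ] ι → ℝ} (hR : ∀ z v, R z v ↔ v = F z) (hF : ContDiffAt ℝ 1 F z₀)
    (hA : HasFDerivAt F A z₀) (h0 : F z₀ = 0) (B : (ι → ℝ) →L[ℝ] (ι → ℝ) →L[ℝ] ℝ)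
    (hpos : ∀ h ≠ 0, 0 < B h h) (hneg : ∀ h ≠ 0, B h (A h) + B (A h) h < 0) :
    IsAsymptoticallyStable R z₀ := by
  obtain rfl : R = fun z v ↦ v = F z := by
    funext z v
    exact propext (hR z v)
  obtain ⟨c, hc, hB⟩ := exists_pos_mul_sq_norm_le (Q := fun h ↦ B h h) (by fun_prop)
    (fun a h ↦ by simp; ring) hpos
  obtain ⟨lam, hlam, r₁, hr₁, hdec⟩ := exists_quadratic_decrease hA h0 B hneg
  -- a norm bound at the initial time puts the state below a given level of the quadratic form
  have level (κ : ℝ) (hκ : 0 < κ) : ∃ δ > 0, ∀ h, ‖h‖ < δ → B h h ≤ κ := by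
    have hc : Tendsto (fun h ↦ B h h) (𝓝 0) (𝓝 0) := by
      have : Continuous fun h ↦ B h h := by fun_prop
      simpa using this.tendsto 0
    obtain ⟨δ, hδ, h⟩ := Metric.eventually_nhds_iff.1 (hc.eventually_lt_const hκ)
    exact ⟨δ, hδ, fun x hx ↦ (h (by rwa [dist_zero_right])).le⟩
  have exp_le (t : ℝ) (ht : 0 ≤ t) : Real.exp (-(lam / 2) * t) ≤ 1 :=
    Real.exp_le_one_iff.2 (by nlinarith)
  refine ⟨h0.symm, fun r hr ↦ ?_, ?_⟩
  · set s := min r₁ (r / 2) with hs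
    have hs0 : 0 < s := by positivity
    obtain ⟨δ, hδ, hδB⟩ := level (c * s ^ 2) (by positivity)
    refine ⟨δ, hδ, fun T z hz hz0 t ht ↦ ?_⟩
    have key := hz.quadratic_le_exp hc hs0 hlam hB
      (fun h hh ↦ hdec h (hh.trans (min_le_left _ _))) (κ := c * s ^ 2) (by positivity) le_rfl
      (hδB _ hz0) ht
    have : c * ‖z t - z₀‖ ^ 2 ≤ c * s ^ 2 :=
      (hB _).trans (key.trans (mul_le_of_le_one_right (by positivity) (exp_le t ht.1)))
    have := (sq_le_sq₀ (norm_nonneg _) hs0.le).1 (le_of_mul_le_mul_left this hc)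
    linarith [min_le_right r₁ (r / 2)]
  · obtain ⟨K, U, hU, hK⟩ := hF.exists_lipschitzOnWith
    obtain ⟨r₂, hr₂, hr₂U⟩ := Metric.nhds_basis_closedBall.mem_iff.1 hU
    set s := min r₁ r₂ with hs
    have hs0 : 0 < s := by positivity
    have hsU : Metric.closedBall z₀ s ⊆ U :=
      (Metric.closedBall_subset_closedBall (min_le_right _ _)).trans hr₂U
    have hdec' : ∀ h, ‖h‖ ≤ s → B h (F (z₀ + h)) + B (F (z₀ + h)) h ≤ -lam * B h h :=
      fun h hh ↦ hdec h (hh.trans (min_le_left _ _))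
    have hκ : 0 < c * s ^ 2 := by positivity
    obtain ⟨δ, hδ, hδB⟩ := level (c * s ^ 2) hκ
    refine ⟨δ, hδ, fun w hw ↦ ?_, fun z hz hz0 ↦ ?_⟩
    · -- solve the equation of the field frozen outside a ball, which the solution never leaves
      have hmem := clampBox_mem_closedBall z₀ hs0.le
      have hG : LipschitzWith K (F ∘ clampBox z₀ s) := by
        have := ((hK.mono hsU).comp ((lipschitzWith_clampBox z₀ s).lipschitzOnWith (s := Set.univ))
          (fun x _ ↦ hmem x))
        rwa [mul_one, lipschitzOnWith_univ] at this
      have hGb (x : ι → ℝ) : ‖(F ∘ clampBox z₀ s) x‖ ≤ (K * s.toNNReal : NNReal) := by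
        have := (hK.mono hsU).dist_le_mul _ (hmem x) z₀ (Metric.mem_closedBall_self hs0.le)
        rw [h0, dist_zero_right] at this
        rw [NNReal.coe_mul, Real.coe_toNNReal _ hs0.le]
        exact this.trans (by gcongr; exact hmem x)
      obtain ⟨z, rfl, hz⟩ := exists_isSolutionOn_Ici hG hGb w
      refine ⟨z, rfl, fun t ht ↦ ?_⟩
      obtain ⟨v, hv, rfl⟩ := hz t ht
      refine ⟨_, hv, congrArg F (clampBox_eq_self ?_)⟩
      have key := (hz.mono (J' := Set.Ico 0 (t + 1)) Set.Ico_subset_Ici_self).quadratic_le_exp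
          hc hs0 hlam hB
        (fun h hh ↦ by
          rw [Function.comp_apply, clampBox_eq_self (by simpa using hh)]
          exact hdec' h hh) hκ le_rfl (hδB _ hw) ⟨ht, lt_add_one t⟩
      have : c * ‖z t - z₀‖ ^ 2 ≤ c * s ^ 2 :=
        (hB _).trans (key.trans (mul_le_of_le_one_right hκ.le (exp_le t ht)))
      rw [mem_closedBall_iff_norm]
      exact (sq_le_sq₀ (norm_nonneg _) hs0.le).1 (le_of_mul_le_mul_left this hc)
    · have key (t : ℝ) (ht : 0 ≤ t) :
          ‖z t - z₀‖ ^ 2 ≤ s ^ 2 * Real.exp (-(lam / 2) * t) := by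
        have := (hz.mono (J' := Set.Ico 0 (t + 1)) Set.Ico_subset_Ici_self).quadratic_le_exp
          hc hs0 hlam hB
          hdec' hκ le_rfl (hδB _ hz0) ⟨ht, lt_add_one t⟩
        refine le_of_mul_le_mul_left ((hB _).trans (this.trans_eq ?_)) hc
        ring
      have hlim : Tendsto (fun t ↦ s ^ 2 * Real.exp (-(lam / 2) * t)) atTop (𝓝 0) := by
        have : Tendsto (fun t : ℝ ↦ -(lam / 2) * t) atTop atBot :=
          tendsto_id.const_mul_atTop_of_neg (by linarith)
        simpa using (Real.tendsto_exp_atBot.comp this).const_mul (s ^ 2)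
      have hsq : Tendsto (fun t ↦ ‖z t - z₀‖ ^ 2) atTop (𝓝 0) :=
        squeeze_zero' (Eventually.of_forall fun t ↦ by positivity)
          ((eventually_ge_atTop 0).mono key) hlim
      rw [tendsto_iff_norm_sub_tendsto_zero]
      simpa [Real.sqrt_sq] using hsq.sqrt

end Lyapunov

/-! ### A quadratic Lyapunov function for the linearized closed loop -/

section LinearizedLoop

/-- Energy of the linearized manipulator with inertia matrix `!![m, -a; -a, J]` and stiffness
`diag (kx, kα)`, corrected by `η` times the product of position and momentum. -/
def slowEnergy (m a J kx kα η y₁ y₂ u₁ u₂ : ℝ) : ℝ :=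
  (m * u₁ ^ 2 - 2 * a * (u₁ * u₂) + J * u₂ ^ 2) / 2 + (kx * y₁ ^ 2 + kα * y₂ ^ 2) / 2 +
    η * (y₁ * (m * u₁ - a * u₂) + y₂ * (J * u₂ - a * u₁))

/-- Derivative of `slowEnergy` along a motion with velocity `u` and acceleration `w`. -/
def slowEnergyDeriv (m a J kx kα η y₁ y₂ u₁ u₂ w₁ w₂ : ℝ) : ℝ :=
  u₁ * (m * w₁ - a * w₂) + u₂ * (J * w₂ - a * w₁) + kx * (y₁ * u₁) + kα * (y₂ * u₂) +
    η * (m * u₁ ^ 2 - 2 * a * (u₁ * u₂) + J * u₂ ^ 2 +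
      y₁ * (m * w₁ - a * w₂) + y₂ * (J * w₂ - a * w₁))

variable {m a J kx vx kα vα c₀ : ℝ}

theorem inertiaForm_pos (hm : 0 < m) (ha : a ^ 2 < m * J) {u₁ u₂ : ℝ}
    (hu : u₁ ≠ 0 ∨ u₂ ≠ 0) : 0 < m * u₁ ^ 2 - 2 * a * (u₁ * u₂) + J * u₂ ^ 2 := by
  refine pos_of_mul_pos_right (a := m) ?_ hm.le
  have hsplit : m * (m * u₁ ^ 2 - 2 * a * (u₁ * u₂) + J * u₂ ^ 2) =
      (m * u₁ - a * u₂) ^ 2 + (m * J - a ^ 2) * u₂ ^ 2 := by ring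
  rw [hsplit]
  have hD : 0 < m * J - a ^ 2 := by linarith
  rcases eq_or_ne u₂ 0 with rfl | h₂
  · have h₁ : u₁ ≠ 0 := by simpa using hu
    simp only [mul_zero, sub_zero, ne_eq, OfNat.ofNat_ne_zero, not_false_eq_true, zero_pow,
      add_zero]
    positivity
  · positivity

/-- For a small coupling `η` the corrected energy is positive definite, and it decreases strictly up
to a term caused by the attitude error `b`, which enters the second equation as a force `c₀ * b`. -/
theorem exists_slowEnergy_decrease (hm : 0 < m) (hJ : 0 < J) (ha : a ^ 2 < m * J) (hkx : 0 < kx)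
    (hvx : 0 < vx) (hkα : 0 < kα) (hvα : 0 < vα) (c₀ : ℝ) :
    ∃ η c C : ℝ, 0 < c ∧ 0 < C ∧
      (∀ y₁ y₂ u₁ u₂, 0 < y₁ ^ 2 + y₂ ^ 2 + u₁ ^ 2 + u₂ ^ 2 →
        0 < slowEnergy m a J kx kα η y₁ y₂ u₁ u₂) ∧
      ∀ y₁ y₂ u₁ u₂ w₁ w₂ b, m * w₁ - a * w₂ = -kx * y₁ - vx * u₁ →
        J * w₂ - a * w₁ = -kα * y₂ - vα * u₂ + c₀ * b →
        slowEnergyDeriv m a J kx kα η y₁ y₂ u₁ u₂ w₁ w₂ ≤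
          -c * (y₁ ^ 2 + y₂ ^ 2 + u₁ ^ 2 + u₂ ^ 2) + C * b ^ 2 := by
  set S := m + J + |a| with hS
  have hS0 : 0 < S := by positivity
  have hform (u₁ u₂ : ℝ) :
      m * u₁ ^ 2 - 2 * a * (u₁ * u₂) + J * u₂ ^ 2 ≤ S * (u₁ ^ 2 + u₂ ^ 2) := by
    have h1 : -(2 * a * (u₁ * u₂)) ≤ |a| * (u₁ ^ 2 + u₂ ^ 2) := by
      rcases abs_cases a with ⟨h, h'⟩ | ⟨h, h'⟩ <;> rw [h]
      · nlinarith [mul_nonneg h' (sq_nonneg (u₁ + u₂))]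
      · nlinarith [mul_nonneg (neg_nonneg.2 h'.le) (sq_nonneg (u₁ - u₂))]
    rw [hS]
    nlinarith [mul_nonneg hm.le (sq_nonneg u₂), mul_nonneg hJ.le (sq_nonneg u₁)]
  -- the conditions on the coupling are all of the form `η * const ≤ const`
  obtain ⟨η, hη, hη1, hη2, hη3, hη4, hη5⟩ : ∃ η > 0, η ≤ 1 ∧ η * S < kx ∧ η * S < kα ∧
      η * (S + vx ^ 2 / (2 * kx)) ≤ vx / 2 ∧ η * (S + vα ^ 2 / (2 * kα)) ≤ vα / 4 := by
    have small {A r : ℝ} (hr : 0 < r) : ∀ᶠ η in 𝓝[>] (0 : ℝ), η * A < r := by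
      refine nhdsWithin_le_nhds ?_
      have : Continuous fun η : ℝ ↦ η * A := by fun_prop
      exact (this.tendsto' 0 0 (zero_mul A)).eventually_lt_const hr
    have h1 := small (A := 1) one_pos
    have h4 := small (A := S + vx ^ 2 / (2 * kx)) (half_pos hvx)
    have h5 := small (A := S + vα ^ 2 / (2 * kα)) (show 0 < vα / 4 by positivity)
    obtain ⟨η, ⟨⟨h1, h2⟩, h3, h4⟩, h5, h0⟩ := ((h1.and (small (A := S) hkx)).and
      ((small (A := S) hkα).and h4) |>.and (h5.and self_mem_nhdsWithin)).exists
    exact ⟨η, h0, by linarith, h2, h3, h4.le, h5.le⟩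
  set c := min (min (vx / 2) (vα / 2)) (min (η * kx / 2) (η * kα / 4)) with hc
  have hc0 : 0 < c := by positivity
  have hc1 : c ≤ vx / 2 := (min_le_left _ _).trans (min_le_left _ _)
  have hc2 : c ≤ vα / 2 := (min_le_left _ _).trans (min_le_right _ _)
  have hc3 : c ≤ η * kx / 2 := (min_le_right _ _).trans (min_le_left _ _)
  have hc4 : c ≤ η * kα / 4 := (min_le_right _ _).trans (min_le_right _ _)
  refine ⟨η, c, c₀ ^ 2 / vα + η * (c₀ ^ 2 / kα) + 1, hc0, by positivity, ?_, ?_⟩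
  · intro y₁ y₂ u₁ u₂ hN
    -- complete the square in the velocities
    have hsplit : slowEnergy m a J kx kα η y₁ y₂ u₁ u₂ =
        (m * (u₁ + η * y₁) ^ 2 - 2 * a * ((u₁ + η * y₁) * (u₂ + η * y₂)) +
          J * (u₂ + η * y₂) ^ 2) / 2 + (kx * y₁ ^ 2 + kα * y₂ ^ 2 -
            η ^ 2 * (m * y₁ ^ 2 - 2 * a * (y₁ * y₂) + J * y₂ ^ 2)) / 2 := by
      rw [slowEnergy]
      ring
    have hηS : η ^ 2 * (m * y₁ ^ 2 - 2 * a * (y₁ * y₂) + J * y₂ ^ 2) ≤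
        η * S * (y₁ ^ 2 + y₂ ^ 2) := by
      calc _ ≤ η ^ 2 * (S * (y₁ ^ 2 + y₂ ^ 2)) := by gcongr; exact hform _ _
        _ ≤ η * (S * (y₁ ^ 2 + y₂ ^ 2)) := by
            gcongr
            nlinarith
        _ = _ := by ring
    have hnn : 0 ≤ m * (u₁ + η * y₁) ^ 2 - 2 * a * ((u₁ + η * y₁) * (u₂ + η * y₂)) +
        J * (u₂ + η * y₂) ^ 2 := by
      by_cases h : u₁ + η * y₁ ≠ 0 ∨ u₂ + η * y₂ ≠ 0
      · exact (inertiaForm_pos hm ha h).le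
      · push Not at h
        simp [h.1, h.2]
    rw [hsplit]
    by_cases hy : y₁ = 0 ∧ y₂ = 0
    · obtain ⟨rfl, rfl⟩ := hy
      have hu : u₁ ≠ 0 ∨ u₂ ≠ 0 := by
        by_contra! h
        simp [h.1, h.2] at hN
      simpa using inertiaForm_pos hm ha hu
    · have : 0 < (kx - η * S) * y₁ ^ 2 + (kα - η * S) * y₂ ^ 2 := by
        have h1 : 0 < kx - η * S := by linarith
        have h2 : 0 < kα - η * S := by linarith
        by_cases h : y₁ = 0
        · have : y₂ ≠ 0 := fun h' ↦ hy ⟨h, h'⟩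
          positivity
        · positivity
      linarith
  · intro y₁ y₂ u₁ u₂ w₁ w₂ b h₁ h₂
    have young {k v : ℝ} (hk : 0 < k) (y u : ℝ) :
        -(v * (y * u)) ≤ k / 2 * y ^ 2 + v ^ 2 / (2 * k) * u ^ 2 := by
      have : k / 2 * y ^ 2 + v ^ 2 / (2 * k) * u ^ 2 + v * (y * u) =
          (k * y + v * u) ^ 2 / (2 * k) := by
        field_simp
        ring
      have : 0 ≤ (k * y + v * u) ^ 2 / (2 * k) := by positivity
      linarith
    have e1 := mul_le_mul_of_nonneg_left (young (v := vx) hkx y₁ u₁) hη.le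
    have e2 := mul_le_mul_of_nonneg_left (young (v := vα) hkα y₂ u₂) hη.le
    have e3 := mul_le_mul_of_nonneg_left (young (k := kα / 2) (v := -c₀) (by positivity) y₂ b) hη.le
    have e4 := young (k := vα / 2) (v := -c₀) (by positivity) u₂ b
    have e5 := mul_le_mul_of_nonneg_left (hform u₁ u₂) hη.le
    have e6 := mul_le_mul_of_nonneg_right hη4 (sq_nonneg u₁)
    have e7 := mul_le_mul_of_nonneg_right hη5 (sq_nonneg u₂)
    have g1 := mul_le_mul_of_nonneg_right hc1 (sq_nonneg u₁)
    have g2 := mul_le_mul_of_nonneg_right hc2 (sq_nonneg u₂)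
    have g3 := mul_le_mul_of_nonneg_right hc3 (sq_nonneg y₁)
    have g4 := mul_le_mul_of_nonneg_right hc4 (sq_nonneg y₂)
    rw [neg_sq, mul_div_cancel₀ (G₀ := ℝ) _ two_ne_zero] at e3 e4
    rw [slowEnergyDeriv, h₁, h₂]
    linarith [sq_nonneg b]

/-- Derivative of the attitude part of the Lyapunov function. The error `b` obeys `b' = w + d` with a
disturbance `d` from the slow motion, and `I w' = -kp b - kv w`. Here `N` stands for the squared norm
of the slow state and `s` for the derivative of the slow energy. A large `μ`, and then gains that are
large compared with `μ`, absorb the disturbance and the attitude term in `s`. -/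
theorem exists_gain_bound {I c C : ℝ} (hI : 0 < I) (hc : 0 < c) (hC : 0 < C) :
    ∃ μ > 0, ∃ K ≥ 1, ∀ kv kp : ℝ, K ≤ kv → K * kv ≤ kp → μ * I < kv ∧
      ∀ N b w d s : ℝ, 0 < N + b ^ 2 + w ^ 2 → 0 ≤ N → d ^ 2 ≤ C * (N + b ^ 2) →
        s ≤ -c * N + C * b ^ 2 →
        kp * s + (-kv * w ^ 2 + kp * (b * d) +
          μ * (I * w ^ 2 + I * (w * d) - kp * b ^ 2 + kv * (b * d))) < 0 := by
  obtain ⟨μ, hμ⟩ : ∃ μ, μ = C + 4 * C / c + c + 1 := ⟨_, rfl⟩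
  have hμ0 : 0 < μ := by rw [hμ]; positivity
  obtain ⟨K, hK⟩ : ∃ K, K = μ + 2 * (μ * I) + 4 * (μ * I * C) / c + μ * I * C + 1 := ⟨_, rfl⟩
  have p1 : 0 < μ * I := by positivity
  have p2 : 0 < μ * I * C := by positivity
  have p3 : 0 < 4 * (μ * I * C) / c := by positivity
  have hK1 : 1 ≤ K := by linarith
  refine ⟨μ, hμ0, K, hK1, fun kv kp hkv hkp ↦ ?_⟩
  have hkv1 : 1 ≤ kv := hK1.trans hkv
  have hμkv : μ * kv ≤ kp := le_trans (by gcongr; linarith) hkp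
  have hKkp : K ≤ kp := le_trans (le_mul_of_one_le_right (by linarith) hkv1) hkp
  have hkp0 : 0 < kp := by linarith
  refine ⟨by linarith, fun N b w d s hpos hN hd hs ↦ ?_⟩
  -- `|b d|` is split so that the disturbance costs at most a quarter of the slow decay rate
  have hbd : |b * d| ≤ c / 4 * (N + b ^ 2) + C / c * b ^ 2 := by
    have h1 : |b * d| ≤ c / (4 * C) * d ^ 2 + C / c * b ^ 2 := by
      rw [abs_mul, ← sq_abs d, ← sq_abs b]
      have : c / (4 * C) * |d| ^ 2 + C / c * |b| ^ 2 - |b| * |d| =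
          (c * |d| - 2 * C * |b|) ^ 2 / (4 * C * c) := by
        field_simp
        ring
      have : 0 ≤ (c * |d| - 2 * C * |b|) ^ 2 / (4 * C * c) := by positivity
      linarith
    have h2 : c / (4 * C) * d ^ 2 ≤ c / (4 * C) * (C * (N + b ^ 2)) := by gcongr
    have h3 : c / (4 * C) * (C * (N + b ^ 2)) = c / 4 * (N + b ^ 2) := by field_simp
    linarith
  have t1 : kp * (b * d) ≤ kp * (c / 4 * (N + b ^ 2) + C / c * b ^ 2) := by
    gcongr
    exact (le_abs_self _).trans hbd
  have t2 : μ * kv * (b * d) ≤ kp * (c / 4 * (N + b ^ 2) + C / c * b ^ 2) := by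
    calc μ * kv * (b * d) ≤ μ * kv * |b * d| := by
          gcongr
          exact le_abs_self _
      _ ≤ kp * |b * d| := by gcongr
      _ ≤ _ := by gcongr
  have t3 : μ * I * (w * d) ≤ μ * I * w ^ 2 + μ * I * C * (N + b ^ 2) := by
    have h1 : w * d ≤ w ^ 2 + d ^ 2 := by nlinarith [sq_nonneg (w - d), sq_nonneg w, sq_nonneg d]
    calc μ * I * (w * d) ≤ μ * I * (w ^ 2 + C * (N + b ^ 2)) := by
          gcongr
          linarith
      _ = _ := by ring
  have t4 : kp * s ≤ kp * (-c * N + C * b ^ 2) := by gcongr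
  have q1 : μ * I * C * N ≤ kp * (c / 4 * N) := by
    have : μ * I * C ≤ kp * (c / 4) := by
      have : 4 * (μ * I * C) / c ≤ kp := by linarith
      rw [div_le_iff₀ hc] at this
      linarith
    nlinarith
  have q2 : μ * I * C * b ^ 2 ≤ kp * b ^ 2 * 1 := by
    rw [mul_one]
    gcongr
    linarith
  have q3 : 2 * (μ * I) * w ^ 2 + w ^ 2 ≤ kv * w ^ 2 := by
    have : 2 * (μ * I) + 1 ≤ kv := by linarith
    nlinarith [sq_nonneg w]
  have hexp : kp * (μ * b ^ 2) = kp * (C * b ^ 2) + 4 * (kp * (C / c * b ^ 2)) +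
      kp * (c * b ^ 2) + kp * b ^ 2 := by
    rw [hμ]
    ring
  have r1 : 0 < kp * (c / 4 * N) + kp * (c / 2 * b ^ 2) + w ^ 2 := by
    by_contra! h
    have a1 : 0 ≤ kp * (c / 4 * N) := by positivity
    have a2 : 0 ≤ kp * (c / 2 * b ^ 2) := by positivity
    have a3 := sq_nonneg w
    have b1 : kp * (c / 4 * N) = 0 := by linarith
    have b2 : kp * (c / 2 * b ^ 2) = 0 := by linarith
    have b3 : w ^ 2 = 0 := by linarith
    have c1 : N = 0 := by simpa [hkp0.ne', hc.ne'] using b1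
    have c2 : b ^ 2 = 0 := by simpa [hkp0.ne', hc.ne'] using b2
    linarith
  have r2 : 0 ≤ kp * (C / c * b ^ 2) := by positivity
  linarith

end LinearizedLoop

section LyapunovForm

/-- Evaluation of the `i`-th coordinate of the state, as a continuous linear functional. -/
abbrev stateCoord (i : Fin 6) : (Fin 6 → ℝ) →L[ℝ] ℝ := ContinuousLinearMap.proj i

/-- The linearized deviation of the attitude from its commanded value, which depends on the
inclination and its rate with slopes `m₁` and `m₂`. -/
def attitudeError (m₁ m₂ : ℝ) : (Fin 6 → ℝ) →L[ℝ] ℝ :=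
  stateCoord 2 - m₁ • stateCoord 1 - m₂ • stateCoord 4

/-- The bilinear form `h, v ↦ f h * g v`. -/
abbrev mulForm (f g : (Fin 6 → ℝ) →L[ℝ] ℝ) : (Fin 6 → ℝ) →L[ℝ] (Fin 6 → ℝ) →L[ℝ] ℝ :=
  f.smulRight g

/-- The Lyapunov function of the linearized loop as a (not necessarily symmetric) bilinear form: `kp`
times the slow energy, plus the energy of the attitude loop with a cross term of weight `μ`. The
factor `kp` keeps both parts comparable when the gains grow. -/
def lyapunovForm (m a J kx kα η I kp kv μ m₁ m₂ : ℝ) :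
    (Fin 6 → ℝ) →L[ℝ] (Fin 6 → ℝ) →L[ℝ] ℝ :=
  let e := attitudeError m₁ m₂
  let P := stateCoord
  kp • ((m / 2) • mulForm (P 3) (P 3) - a • mulForm (P 3) (P 4) + (J / 2) • mulForm (P 4) (P 4) +
      (kx / 2) • mulForm (P 0) (P 0) + (kα / 2) • mulForm (P 1) (P 1) +
      η • (mulForm (P 0) (m • P 3 - a • P 4) + mulForm (P 1) (J • P 4 - a • P 3))) +
    (kp / 2) • mulForm e e + (I / 2) • mulForm (P 5) (P 5) +
    μ • (I • mulForm e (P 5) + (kv / 2) • mulForm e e)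

theorem attitudeError_apply (m₁ m₂ : ℝ) (h : Fin 6 → ℝ) :
    attitudeError m₁ m₂ h = h 2 - m₁ * h 1 - m₂ * h 4 := by
  simp [attitudeError]

theorem lyapunovForm_apply_self (m a J kx kα η I kp kv μ m₁ m₂ : ℝ) (h : Fin 6 → ℝ) :
    lyapunovForm m a J kx kα η I kp kv μ m₁ m₂ h h =
      kp * slowEnergy m a J kx kα η (h 0) (h 1) (h 3) (h 4) +
        (kp * attitudeError m₁ m₂ h ^ 2 + I * (h 5 + μ * attitudeError m₁ m₂ h) ^ 2 +
          μ * (kv - μ * I) * attitudeError m₁ m₂ h ^ 2) / 2 := by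
  simp [lyapunovForm, slowEnergy]
  ring

theorem lyapunovForm_add_swap (m a J kx kα η I kp kv μ m₁ m₂ : ℝ) {h v : Fin 6 → ℝ}
    (h₀ : v 0 = h 3) (h₁ : v 1 = h 4) (h₂ : v 2 = h 5)
    (h₅ : I * v 5 = -kp * attitudeError m₁ m₂ h - kv * h 5) :
    lyapunovForm m a J kx kα η I kp kv μ m₁ m₂ h v +
        lyapunovForm m a J kx kα η I kp kv μ m₁ m₂ v h =
      kp * slowEnergyDeriv m a J kx kα η (h 0) (h 1) (h 3) (h 4) (v 3) (v 4) +
        (-kv * h 5 ^ 2 + kp * (attitudeError m₁ m₂ h * (-m₁ * h 4 - m₂ * v 4)) +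
          μ * (I * h 5 ^ 2 + I * (h 5 * (-m₁ * h 4 - m₂ * v 4)) -
            kp * attitudeError m₁ m₂ h ^ 2 +
            kv * (attitudeError m₁ m₂ h * (-m₁ * h 4 - m₂ * v 4)))) := by
  have hv : attitudeError m₁ m₂ v = h 5 - m₁ * h 4 - m₂ * v 4 := by
    rw [attitudeError_apply, h₁, h₂]
  simp [lyapunovForm, slowEnergyDeriv, h₀, h₁, hv]
  linear_combination (h 5 + μ * attitudeError m₁ m₂ h) * h₅

/-- The acceleration of the slow part is bounded by the slow state and the attitude error, so the
rate at which the commanded attitude moves is bounded independently of the attitude gains. -/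
theorem exists_sq_commandRate_le {m a J : ℝ} (ha : a ^ 2 < m * J) (kx vx kα vα c₀ m₁ m₂ : ℝ) :
    ∃ C : ℝ, ∀ y₁ y₂ u₁ u₂ w₁ w₂ b, m * w₁ - a * w₂ = -kx * y₁ - vx * u₁ →
      J * w₂ - a * w₁ = -kα * y₂ - vα * u₂ + c₀ * b →
      (-m₁ * u₂ - m₂ * w₂) ^ 2 ≤ C * (y₁ ^ 2 + y₂ ^ 2 + u₁ ^ 2 + u₂ ^ 2 + b ^ 2) := by
  have hD : m * J - a ^ 2 ≠ 0 := by linarith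
  set r := m₂ / (m * J - a ^ 2) with hr
  refine ⟨(r * (a * kx)) ^ 2 + (r * (m * kα)) ^ 2 + (r * (a * vx)) ^ 2 +
    (r * (m * vα) - m₁) ^ 2 + (r * (m * c₀)) ^ 2, fun y₁ y₂ u₁ u₂ w₁ w₂ b h₁ h₂ ↦ ?_⟩
  have hw : m₂ * w₂ = r * (a * (-kx * y₁ - vx * u₁) + m * (-kα * y₂ - vα * u₂ + c₀ * b)) := by
    rw [← h₁, ← h₂, hr]
    field_simp
    ring
  have hd : -m₁ * u₂ - m₂ * w₂ = r * (a * kx) * y₁ + r * (m * kα) * y₂ + r * (a * vx) * u₁ +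
      (r * (m * vα) - m₁) * u₂ + -(r * (m * c₀)) * b := by
    rw [hw]
    ring
  rw [hd]
  -- the Cauchy–Schwarz inequality in dimension five
  have cs := Finset.sum_mul_sq_le_sq_mul_sq Finset.univ
    ![r * (a * kx), r * (m * kα), r * (a * vx), r * (m * vα) - m₁, -(r * (m * c₀))]
    ![y₁, y₂, u₁, u₂, b]
  simpa [Fin.sum_univ_five] using cs

theorem eq_zero_of_sum_sq_eq_zero {x y z w : ℝ} (h : x ^ 2 + y ^ 2 + z ^ 2 + w ^ 2 = 0) :
    x = 0 ∧ y = 0 ∧ z = 0 ∧ w = 0 := by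
  refine ⟨?_, ?_, ?_, ?_⟩ <;> refine pow_eq_zero_iff two_ne_zero |>.1 ?_ <;>
    linarith [sq_nonneg x, sq_nonneg y, sq_nonneg z, sq_nonneg w]

theorem sq_add_sq_attitudeError_pos (m₁ m₂ : ℝ) {h : Fin 6 → ℝ} (hh : h ≠ 0) :
    0 < h 0 ^ 2 + h 1 ^ 2 + h 3 ^ 2 + h 4 ^ 2 + attitudeError m₁ m₂ h ^ 2 + h 5 ^ 2 := by
  by_contra! hle
  have n1 : 0 ≤ h 0 ^ 2 + h 1 ^ 2 + h 3 ^ 2 + h 4 ^ 2 := by positivity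
  have n2 := sq_nonneg (attitudeError m₁ m₂ h)
  have n3 := sq_nonneg (h 5)
  obtain ⟨e0, e1, e3, e4⟩ :=
    eq_zero_of_sum_sq_eq_zero (x := h 0) (y := h 1) (z := h 3) (w := h 4) (by linarith)
  have eb : attitudeError m₁ m₂ h = 0 := pow_eq_zero_iff two_ne_zero |>.1 (by linarith)
  have e5 : h 5 = 0 := pow_eq_zero_iff two_ne_zero |>.1 (by linarith)
  have e2 : h 2 = 0 := by simpa [attitudeError_apply, e1, e4] using eb
  exact hh (funext fun i ↦ by fin_cases i <;> assumption)

/-- For all large attitude gains, uniformly in the region `K ≤ kv`, `K * kv ≤ kp`, the linearized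
loop has a strict quadratic Lyapunov function. -/
theorem exists_lyapunovForm {m a J kx vx kα vα I : ℝ} (hm : 0 < m) (hJ : 0 < J)
    (ha : a ^ 2 < m * J) (hkx : 0 < kx) (hvx : 0 < vx) (hkα : 0 < kα) (hvα : 0 < vα) (hI : 0 < I)
    (c₀ m₁ m₂ : ℝ) :
    ∃ K > 0, ∀ kv kp : ℝ, K ≤ kv → K * kv ≤ kp →
      ∃ B : (Fin 6 → ℝ) →L[ℝ] (Fin 6 → ℝ) →L[ℝ] ℝ, (∀ h ≠ 0, 0 < B h h) ∧
        ∀ h ≠ 0, ∀ v : Fin 6 → ℝ, v 0 = h 3 → v 1 = h 4 → v 2 = h 5 →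
          m * v 3 - a * v 4 = -kx * h 0 - vx * h 3 →
          J * v 4 - a * v 3 = -kα * h 1 - vα * h 4 + c₀ * attitudeError m₁ m₂ h →
          I * v 5 = -kp * attitudeError m₁ m₂ h - kv * h 5 → B h v + B v h < 0 := by
  obtain ⟨η, c, C₁, hc, hC₁, hE, hE'⟩ := exists_slowEnergy_decrease hm hJ ha hkx hvx hkα hvα c₀
  obtain ⟨C₂, hC₂⟩ := exists_sq_commandRate_le ha kx vx kα vα c₀ m₁ m₂
  obtain ⟨μ, hμ, K, hK, hgain⟩ := exists_gain_bound hI hc (lt_max_of_lt_left hC₁ : 0 < max C₁ C₂)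
  refine ⟨K, by linarith, fun kv kp hkv hkp ↦
    ⟨lyapunovForm m a J kx kα η I kp kv μ m₁ m₂, fun h hh ↦ ?_,
      fun h hh v h₀ h₁ h₂ h₃ h₄ h₅ ↦ ?_⟩⟩
  all_goals
    have hkp0 : 0 < kp := by nlinarith
    obtain ⟨hμI, hfast⟩ := hgain kv kp hkv hkp
    have hpos := sq_add_sq_attitudeError_pos m₁ m₂ hh
    have hN : 0 ≤ h 0 ^ 2 + h 1 ^ 2 + h 3 ^ 2 + h 4 ^ 2 := by positivity
  · rw [lyapunovForm_apply_self]
    have hμ' : 0 < μ * (kv - μ * I) := mul_pos hμ (by linarith)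
    rcases hN.eq_or_lt' with hN0 | hN0
    · obtain ⟨e0, e1, e3, e4⟩ := eq_zero_of_sum_sq_eq_zero hN0
      have hs : slowEnergy m a J kx kα η (h 0) (h 1) (h 3) (h 4) = 0 := by
        simp [slowEnergy, e0, e1, e3, e4]
      rw [hs]
      rcases eq_or_ne (attitudeError m₁ m₂ h) 0 with hb0 | hb0
      · have h5 : h 5 ≠ 0 := by
          intro h5
          simp [hN0, hb0, h5] at hpos
        rw [hb0]
        simp only [mul_zero, add_zero]
        positivity
      · positivity
    · have := hE _ _ _ _ hN0
      positivity
  · rw [lyapunovForm_add_swap m a J kx kα η I kp kv μ m₁ m₂ h₀ h₁ h₂ h₅]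
    refine hfast _ _ (h 5) _ _ hpos hN ?_ ?_
    · refine (hC₂ _ _ _ _ _ _ _ h₃ h₄).trans ?_
      gcongr
      exact le_max_right _ _
    · refine (hE' _ _ _ _ _ _ _ h₃ h₄).trans ?_
      gcongr
      exact le_max_left _ _

end LyapunovForm

/-! ### The attitude command and the normalized thrust near the equilibrium -/

theorem AnalyticAt.dslope {f : ℝ → ℝ} {x₀ x : ℝ} (h₀ : AnalyticAt ℝ f x₀)
    (h : AnalyticAt ℝ f x) : AnalyticAt ℝ (dslope f x₀) x := by
  rcases eq_or_ne x x₀ with rfl | hx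
  · obtain ⟨q, hq⟩ := h₀
    exact hq.has_fpower_series_dslope_fslope.analyticAt
  · have hinv : AnalyticAt ℝ (fun y ↦ (y - x₀)⁻¹ * (f y - f x₀)) x :=
      ((analyticAt_id.sub analyticAt_const).inv (sub_ne_zero.2 hx)).mul (h.sub analyticAt_const)
    exact hinv.congr ((dslope_eventuallyEq_slope_of_ne f hx).trans
      (Eventually.of_forall fun y ↦ by simp [slope])).symm

namespace UavUgv

variable (p : Plant) (k : Gains)

theorem gammaPar_pos : 0 < gammaPar p k := by
  have : 0 < Real.arctan (k.ε * (p.T_max * p.L)) :=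
    Real.arctan_pos.2 (mul_pos k.ε_pos (mul_pos p.T_max_pos p.L_pos))
  unfold gammaPar
  positivity

theorem sat_of_abs_le {b y : ℝ} (h : |y| ≤ b) : sat b y = y := by
  rw [sat, min_eq_left h]
  rcases lt_trichotomy y 0 with hy | rfl | hy
  · rw [Real.sign_of_neg hy, abs_of_neg hy]
    ring
  · simp
  · rw [Real.sign_of_pos hy, abs_of_pos hy, one_mul]

theorem abs_gammaPar_mul_arctan_lt {f : ℝ} (hf : |f| < p.T_max * p.L) :
    |gammaPar p k * Real.arctan (k.ε * f)| < Real.pi / 2 := by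
  have hA : 0 < Real.arctan (k.ε * (p.T_max * p.L)) :=
    Real.arctan_pos.2 (mul_pos k.ε_pos (mul_pos p.T_max_pos p.L_pos))
  have harc : |Real.arctan (k.ε * f)| < Real.arctan (k.ε * (p.T_max * p.L)) := by
    obtain ⟨h1, h2⟩ := abs_lt.1 hf
    rw [abs_lt, ← Real.arctan_neg, ← mul_neg]
    exact ⟨Real.arctan_strictMono (mul_lt_mul_of_pos_left h1 k.ε_pos),
      Real.arctan_strictMono (mul_lt_mul_of_pos_left h2 k.ε_pos)⟩
  rw [abs_mul, abs_of_pos (gammaPar_pos p k)]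
  calc _ < gammaPar p k * Real.arctan (k.ε * (p.T_max * p.L)) :=
        mul_lt_mul_of_pos_left harc (gammaPar_pos p k)
    _ = Real.pi / 2 := by
        rw [gammaPar]
        generalize Real.arctan (k.ε * (p.T_max * p.L)) = A at hA
        field_simp

/-- Below the maximal thrust the attitude command is not saturated. -/
theorem thetaD_eq {f : ℝ} (hf : |f| < p.T_max * p.L) :
    thetaD p k f = gammaPar p k * Real.arctan (k.ε * f) :=
  sat_of_abs_le (abs_gammaPar_mul_arctan_lt p k hf).le

theorem eventually_abs_lt {f b : ℝ} (hf : |f| < b) : ∀ᶠ x in 𝓝 f, |x| < b :=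
  continuous_abs.continuousAt.eventually_lt_const hf

theorem contDiffAt_thetaD {f : ℝ} (hf : |f| < p.T_max * p.L) :
    ContDiffAt ℝ 1 (thetaD p k) f := by
  refine ContDiffAt.congr_of_eventuallyEq
    (f := fun x ↦ gammaPar p k * Real.arctan (k.ε * x)) ?_
    ((eventually_abs_lt hf).mono fun x hx ↦ thetaD_eq p k hx)
  exact contDiffAt_const.mul (contDiffAt_const.mul contDiffAt_id).arctan

theorem sin_gammaPar_mul_arctan_ne_zero {f : ℝ} (hf : |f| < p.T_max * p.L) (h0 : f ≠ 0) :
    Real.sin (gammaPar p k * Real.arctan (k.ε * f)) ≠ 0 := by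
  have hlt := abs_lt.1 (abs_gammaPar_mul_arctan_lt p k hf)
  have hpi := Real.pi_pos
  rw [Ne, Real.sin_eq_zero_iff_of_lt_of_lt (by linarith) (by linarith)]
  exact mul_ne_zero (gammaPar_pos p k).ne'
    (Real.arctan_eq_zero_iff.not.2 (mul_ne_zero k.ε_pos.ne' h0))

/-- The defining property of the normalized thrust: at the commanded attitude the tangential force
is the requested one. -/
theorem normalizedThrust_mul_sin {f : ℝ} (hf : |f| < p.T_max * p.L) :
    normalizedThrust p k f * Real.sin (thetaD p k f) = f := by
  rcases eq_or_ne f 0 with rfl | h0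
  · rw [thetaD_eq p k hf]
    simp
  · have := sin_gammaPar_mul_arctan_ne_zero p k hf h0
    rw [normalizedThrust, if_neg h0, thetaD_eq p k hf, div_mul_cancel₀ _ this]

/-- The normalized thrust is `C¹` also across `f = 0`: its inverse is the difference quotient at `0`
of the real analytic function `f ↦ sin (γ arctan (ε f))`. -/
theorem contDiffAt_normalizedThrust {f : ℝ} (hf : |f| < p.T_max * p.L) :
    ContDiffAt ℝ 1 (normalizedThrust p k) f := by
  set S : ℝ → ℝ := fun x ↦ Real.sin (gammaPar p k * Real.arctan (k.ε * x)) with hS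
  have hSd (x : ℝ) : AnalyticAt ℝ S x := by
    have : ContDiff ℝ ⊤ S := Real.contDiff_sin.comp (contDiff_const.mul
      (Real.contDiff_arctan.comp (contDiff_const.mul contDiff_id)))
    exact this.contDiffAt.analyticAt
  have hS0 : S 0 = 0 := by simp [hS]
  have hder : deriv S 0 = gammaPar p k * k.ε := by
    have h := ((((hasDerivAt_id (0 : ℝ)).const_mul k.ε).arctan).const_mul (gammaPar p k)).sin
    have h' : HasDerivAt S _ 0 := h
    rw [h'.deriv]
    simp
  have hpos : 0 < gammaPar p k * k.ε := mul_pos (gammaPar_pos p k) k.ε_pos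
  have heq (x : ℝ) (hx : |x| < p.T_max * p.L) : normalizedThrust p k x = (dslope S 0 x)⁻¹ := by
    rcases eq_or_ne x 0 with rfl | h0
    · rw [normalizedThrust, if_pos rfl, dslope_same, hder, one_div]
    · rw [normalizedThrust, if_neg h0, thetaD_eq p k hx, dslope_of_ne _ h0, slope_def_field, hS0]
      simp [hS]
  have hne : dslope S 0 f ≠ 0 := by
    rcases eq_or_ne f 0 with rfl | h0
    · rw [dslope_same, hder]
      exact hpos.ne'
    · rw [dslope_of_ne _ h0, slope_def_field, hS0, sub_zero, sub_zero]
      exact div_ne_zero (sin_gammaPar_mul_arctan_ne_zero p k hf h0) h0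
  exact (((hSd 0).dslope (hSd f)).contDiffAt.inv hne).congr_of_eventuallyEq
    ((eventually_abs_lt hf).mono heq)

/-- The slopes of the normalized thrust and of the attitude command compensate each other, so the
linearized tangential force is the requested one plus a multiple of the attitude error. -/
theorem deriv_normalizedThrust_add {f : ℝ} (hf : |f| < p.T_max * p.L) :
    deriv (normalizedThrust p k) f * Real.sin (thetaD p k f) +
      normalizedThrust p k f * (Real.cos (thetaD p k f) * deriv (thetaD p k) f) = 1 := by
  have h1 := ((contDiffAt_normalizedThrust p k hf).differentiableAt one_ne_zero).hasDerivAt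
  have h2 := ((contDiffAt_thetaD p k hf).differentiableAt one_ne_zero).hasDerivAt
  have h3 : HasDerivAt (fun x ↦ normalizedThrust p k x * Real.sin (thetaD p k x)) 1 f :=
    (hasDerivAt_id f).congr_of_eventuallyEq
      ((eventually_abs_lt hf).mono fun x hx ↦ normalizedThrust_mul_sin p k hx)
  exact (h1.mul h2.sin).unique h3

/-! ### The plant and its equilibrium -/

namespace Plant

theorem totalMass_pos : 0 < p.totalMass := by
  have := p.m_a_pos
  have := p.m_b_pos
  have := p.m_s_pos
  unfold totalMass
  positivity

theorem apparentMass_pos : 0 < p.apparentMass := by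
  have := p.m_a_pos
  have := p.m_b_pos
  have := p.L_pos
  have := p.d_G_pos
  unfold apparentMass
  positivity

theorem inertia_pos : 0 < p.inertia := by
  have := p.m_a_pos
  have := p.m_b_pos
  have := p.L_pos
  have := p.d_G_pos
  have := p.I_b_pos
  unfold inertia
  positivity

/-- The inertia matrix is positive definite at every inclination. -/
theorem sq_lt_totalMass_mul_inertia (α : ℝ) :
    (p.apparentMass * p.L * Real.sin α) ^ 2 < p.totalMass * (p.inertia * p.L) := by
  have ha := p.m_a_pos
  have hb := p.m_b_pos
  have hs := p.m_s_pos
  have hL := p.L_pos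
  have hd := p.d_G_pos
  have hI := p.I_b_pos
  have e1 : p.apparentMass * p.L = p.m_b * p.d_G + p.m_a * p.L := by
    unfold apparentMass
    field_simp
  have e2 : p.inertia * p.L = p.m_b * p.d_G ^ 2 + p.I_b + p.m_a * p.L ^ 2 := by
    unfold inertia
    field_simp
  calc (p.apparentMass * p.L * Real.sin α) ^ 2
      = (p.apparentMass * p.L) ^ 2 * Real.sin α ^ 2 := by ring
    _ ≤ (p.apparentMass * p.L) ^ 2 := mul_le_of_le_one_right (sq_nonneg _) (Real.sin_sq_le_one α)
    _ ≤ (p.m_b + p.m_a) * (p.m_b * p.d_G ^ 2 + p.m_a * p.L ^ 2) := by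
        rw [e1]
        have : (p.m_b + p.m_a) * (p.m_b * p.d_G ^ 2 + p.m_a * p.L ^ 2) -
            (p.m_b * p.d_G + p.m_a * p.L) ^ 2 = p.m_b * p.m_a * (p.d_G - p.L) ^ 2 := by ring
        have : 0 ≤ p.m_b * p.m_a * (p.d_G - p.L) ^ 2 := by positivity
        linarith
    _ < p.totalMass * (p.inertia * p.L) := by
        rw [e2, totalMass]
        gcongr
        · linarith
        · linarith

/-- At an attainable inclination the thrust that balances gravity is below the maximal one. -/
theorem abs_gravity_lt {α : ℝ} (hα : α ∈ Set.Ioo p.alphaMin p.alphaMax) :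
    |p.apparentMass * p.L * p.g * Real.cos α| < p.T_max * p.L := by
  have hL := p.L_pos
  have hMg : 0 < p.apparentMass * p.g := mul_pos p.apparentMass_pos p.g_pos
  suffices h : |Real.cos α| * (p.apparentMass * p.g) < p.T_max by
    rw [show p.apparentMass * p.L * p.g * Real.cos α =
      Real.cos α * (p.apparentMass * p.g) * p.L by ring, abs_mul, abs_mul, abs_of_pos hMg,
      abs_of_pos hL]
    exact mul_lt_mul_of_pos_right h hL
  obtain ⟨h1, h2⟩ := hα
  unfold alphaMin at h1
  unfold alphaMax at h2
  split_ifs at h1 h2 with hT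
  · rw [← lt_div_iff₀ hMg]
    have hq1 : p.T_max / (p.apparentMass * p.g) < 1 := (div_lt_one hMg).2 hT
    have hq0 : 0 < p.T_max / (p.apparentMass * p.g) := div_pos p.T_max_pos hMg
    have hα0 : 0 ≤ α := (Real.arccos_nonneg _).trans h1.le
    have hαπ : α ≤ Real.pi := h2.le.trans (Real.arccos_le_pi _)
    rw [neg_div] at h2
    have c1 := Real.strictAntiOn_cos ⟨Real.arccos_nonneg _, Real.arccos_le_pi _⟩ ⟨hα0, hαπ⟩ h1
    have c2 := Real.strictAntiOn_cos ⟨hα0, hαπ⟩ ⟨Real.arccos_nonneg _, Real.arccos_le_pi _⟩ h2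
    rw [Real.cos_arccos (by linarith) (by linarith)] at c1 c2
    exact abs_lt.2 ⟨c2, c1⟩
  · have hπ := Real.pi_pos
    have c1 := Real.strictAntiOn_cos ⟨le_rfl, hπ.le⟩ ⟨h1.le, h2.le⟩ h1
    have c2 := Real.strictAntiOn_cos ⟨h1.le, h2.le⟩ ⟨hπ.le, le_rfl⟩ h2
    rw [Real.cos_zero] at c1
    rw [Real.cos_pi] at c2
    have : |Real.cos α| < 1 := abs_lt.2 ⟨c2, c1⟩
    nlinarith

end Plant

/-! ### The closed loop as an explicit vector field and its linearization -/

section VectorField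

variable (kp_β kv_β x_d α_d : ℝ)

/-- The force on the cart in the first row of the equations of motion, with the Coriolis term moved
to the right-hand side. -/
def cartForce (z : Fin 6 → ℝ) : ℝ :=
  k.kp_x * (x_d - z 0) - k.kv_x * z 3 + p.apparentMass * p.L * z 4 * Real.cos (z 1) * z 4

/-- The generalized force on the inclination in the second row of the equations of motion, with the
gravity term moved to the right-hand side. -/
def tiltForce (z : Fin 6 → ℝ) : ℝ :=
  normalizedThrust p k (tangentialForce p k α_d (z 1) (z 4)) * Real.sin (z 2 - z 1) -
    p.apparentMass * p.L * p.g * Real.cos (z 1)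

/-- Determinant of the inertia matrix. -/
def massDet (α : ℝ) : ℝ :=
  p.totalMass * (p.inertia * p.L) - (p.apparentMass * p.L * Real.sin α) ^ 2

/-- The closed loop solved for the velocity of the state, by Cramer's rule. -/
def closedLoopField (z : Fin 6 → ℝ) : Fin 6 → ℝ :=
  ![z 3, z 4, z 5,
    (p.inertia * p.L * cartForce p k x_d z +
      p.apparentMass * p.L * Real.sin (z 1) * tiltForce p k α_d z) / massDet p (z 1),
    (p.apparentMass * p.L * Real.sin (z 1) * cartForce p k x_d z +
      p.totalMass * tiltForce p k α_d z) / massDet p (z 1),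
    (kp_β * (betaD p k α_d (z 1) (z 4) - z 2) - kv_β * z 5) / p.I_a]

theorem massDet_ne_zero (α : ℝ) : massDet p α ≠ 0 :=
  (sub_pos.2 (p.sq_lt_totalMass_mul_inertia α)).ne'

theorem closedLoop_iff_rows (z v : Fin 6 → ℝ) :
    closedLoop p k kp_β kv_β x_d α_d z v ↔ v 0 = z 3 ∧ v 1 = z 4 ∧ v 2 = z 5 ∧
      (p.totalMass * v 3 - p.apparentMass * p.L * Real.sin (z 1) * v 4 = cartForce p k x_d z ∧
      p.inertia * p.L * v 4 - p.apparentMass * p.L * Real.sin (z 1) * v 3 = tiltForce p k α_d z) ∧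
      p.I_a * v 5 = kp_β * (betaD p k α_d (z 1) (z 4) - z 2) - kv_β * z 5 := by
  have hrows : (p.massMatrix (z 1) *ᵥ ![v 3, v 4] + p.coriolisMatrix (z 1) (z 4) *ᵥ ![z 3, z 4] +
      p.gravityVector (z 1) = ![k.kp_x * (x_d - z 0) - k.kv_x * z 3,
        normalizedThrust p k (tangentialForce p k α_d (z 1) (z 4)) * Real.sin (z 2 - z 1)]) ↔
      (p.totalMass * v 3 - p.apparentMass * p.L * Real.sin (z 1) * v 4 = cartForce p k x_d z ∧
      p.inertia * p.L * v 4 - p.apparentMass * p.L * Real.sin (z 1) * v 3 =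
        tiltForce p k α_d z) := by
    rw [funext_iff, Fin.forall_fin_two, cartForce, tiltForce]
    simp only [Plant.massMatrix, Plant.coriolisMatrix, Plant.gravityVector, Pi.add_apply,
      Matrix.mulVec, dotProduct, Fin.sum_univ_two, Matrix.of_apply, Matrix.cons_val_zero,
      Matrix.cons_val_one, Matrix.cons_val', Matrix.cons_val_fin_one]
    constructor <;> rintro ⟨h1, h2⟩ <;> constructor <;> linarith
  unfold closedLoop
  simp only [hrows]

theorem closedLoop_iff (z v : Fin 6 → ℝ) :
    closedLoop p k kp_β kv_β x_d α_d z v ↔ v = closedLoopField p k kp_β kv_β x_d α_d z := by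
  have hD := massDet_ne_zero p (z 1)
  have hI := p.I_a_pos.ne'
  rw [closedLoop_iff_rows]
  constructor
  · rintro ⟨h0, h1, h2, ⟨h3, h4⟩, h5⟩
    funext i
    fin_cases i
    · exact h0
    · exact h1
    · exact h2
    · change v 3 = _ / _
      rw [eq_div_iff hD, ← h3, ← h4, massDet]
      ring
    · change v 4 = _ / _
      rw [eq_div_iff hD, ← h3, ← h4, massDet]
      ring
    · change v 5 = _ / _
      rw [eq_div_iff hI, ← h5]
      ring
  · rintro rfl
    refine ⟨rfl, rfl, rfl, ⟨?_, ?_⟩, ?_⟩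
    · change p.totalMass * (_ / _) - _ * (_ / _) = _
      field_simp
      rw [massDet]
      ring
    · change p.inertia * p.L * (_ / _) - _ * (_ / _) = _
      field_simp
      rw [massDet]
      ring
    · change p.I_a * (_ / _) = _
      field_simp

variable {α_d}

theorem contDiffAt_closedLoopField {z : Fin 6 → ℝ}
    (hf : |tangentialForce p k α_d (z 1) (z 4)| < p.T_max * p.L) :
    ContDiffAt ℝ 1 (closedLoopField p k kp_β kv_β x_d α_d) z := by
  have hft : ContDiffAt ℝ 1 (fun z : Fin 6 → ℝ ↦ tangentialForce p k α_d (z 1) (z 4)) z := by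
    unfold tangentialForce
    fun_prop
  have hθ : ContDiffAt ℝ 1 (fun z : Fin 6 → ℝ ↦ betaD p k α_d (z 1) (z 4)) z :=
    ContDiffAt.add (by fun_prop)
      (ContDiffAt.comp (g := thetaD p k) z (contDiffAt_thetaD p k hf) hft)
  have hu : ContDiffAt ℝ 1
      (fun z : Fin 6 → ℝ ↦ normalizedThrust p k (tangentialForce p k α_d (z 1) (z 4))) z :=
    ContDiffAt.comp (g := normalizedThrust p k) z (contDiffAt_normalizedThrust p k hf) hft
  have hc : ContDiffAt ℝ 1 (cartForce p k x_d) z := by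
    unfold cartForce
    fun_prop
  have ht : ContDiffAt ℝ 1 (tiltForce p k α_d) z := by
    unfold tiltForce
    fun_prop
  have hD : ContDiffAt ℝ 1 (fun z : Fin 6 → ℝ ↦ massDet p (z 1)) z := by
    unfold massDet
    fun_prop
  have hs : ContDiffAt ℝ 1 (fun z : Fin 6 → ℝ ↦ p.apparentMass * p.L * Real.sin (z 1)) z := by
    fun_prop
  refine contDiffAt_pi.2 fun i ↦ ?_
  fin_cases i
  · exact contDiffAt_apply ℝ ℝ (3 : Fin 6) z
  · exact contDiffAt_apply ℝ ℝ (4 : Fin 6) z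
  · exact contDiffAt_apply ℝ ℝ (5 : Fin 6) z
  · exact ((contDiffAt_const.mul hc).add (hs.mul ht)).div hD (massDet_ne_zero p _)
  · exact ((hs.mul hc).add (contDiffAt_const.mul ht)).div hD (massDet_ne_zero p _)
  · exact ((contDiffAt_const.mul (hθ.sub (contDiffAt_apply ℝ ℝ (2 : Fin 6) z))).sub
      (contDiffAt_const.mul (contDiffAt_apply ℝ ℝ (5 : Fin 6) z))).div_const _

theorem tangentialForce_self (α : ℝ) :
    tangentialForce p k α α 0 = p.apparentMass * p.L * p.g * Real.cos α := by
  simp [tangentialForce]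

theorem closedLoopField_equilibriumState (hα : α_d ∈ Set.Ioo p.alphaMin p.alphaMax) :
    closedLoopField p k kp_β kv_β x_d α_d (equilibriumState p k x_d α_d) = 0 := by
  symm
  rw [← closedLoop_iff, closedLoop_iff_rows]
  have hf := p.abs_gravity_lt hα
  have hsin := normalizedThrust_mul_sin p k hf
  have hc : cartForce p k x_d (equilibriumState p k x_d α_d) = 0 := by
    simp [cartForce, equilibriumState]
  have ht : tiltForce p k α_d (equilibriumState p k x_d α_d) = 0 := by
    simp [tiltForce, equilibriumState, steadyBeta, betaD, tangentialForce_self, hsin]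
  rw [hc, ht]
  simp [equilibriumState, steadyBeta]

/-- The linearization of the closed loop at the equilibrium, in implicit form. The tangential force
enters as the PD law plus a multiple of the error between the attitude and its command. -/
theorem linearization_closedLoopField (hα : α_d ∈ Set.Ioo p.alphaMin p.alphaMax)
    {A : (Fin 6 → ℝ) →L[ℝ] Fin 6 → ℝ}
    (hA : HasFDerivAt (closedLoopField p k kp_β kv_β x_d α_d) A (equilibriumState p k x_d α_d))
    {f₀ θ' a e : ℝ} (hf₀ : f₀ = p.apparentMass * p.L * p.g * Real.cos α_d)
    (hθ' : θ' = deriv (thetaD p k) f₀) (ha : a = p.apparentMass * p.L * Real.sin α_d)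
    (h : Fin 6 → ℝ)
    (he : e = attitudeError (1 - θ' * (k.kp_α + a * p.g)) (-θ' * k.kv_α) h) :
    A h 0 = h 3 ∧ A h 1 = h 4 ∧ A h 2 = h 5 ∧
      p.totalMass * A h 3 - a * A h 4 = -k.kp_x * h 0 - k.kv_x * h 3 ∧
      p.inertia * p.L * A h 4 - a * A h 3 = -k.kp_α * h 1 - k.kv_α * h 4 +
        normalizedThrust p k f₀ * Real.cos (thetaD p k f₀) * e ∧
      p.I_a * A h 5 = -kp_β * e - kv_β * h 5 := by
  have hf : |f₀| < p.T_max * p.L := hf₀ ▸ p.abs_gravity_lt hα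
  set z₀ := equilibriumState p k x_d α_d with hz₀
  set F := closedLoopField p k kp_β kv_β x_d α_d with hF
  have hline : HasDerivAt (fun t : ℝ ↦ F (z₀ + t • h)) (A h) 0 := hA.hasLineDerivAt h
  have hφ := hasDerivAt_pi.1 hline
  have hF0 : F z₀ = 0 := closedLoopField_equilibriumState p k kp_β kv_β x_d hα
  have hφ0 (i : Fin 6) : F (z₀ + (0 : ℝ) • h) i = 0 := by simp [hF0]
  have rel (t : ℝ) := (closedLoop_iff_rows p k kp_β kv_β x_d α_d (z₀ + t • h) _).1
    ((closedLoop_iff p k kp_β kv_β x_d α_d _ _).2 rfl)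
  have e1 : z₀ 1 = α_d := rfl
  have e2 : z₀ 2 = α_d + thetaD p k f₀ := by
    rw [hf₀, ← tangentialForce_self p k]
    rfl
  have e4 : z₀ 4 = 0 := rfl
  have hz (i : Fin 6) : HasDerivAt (fun t : ℝ ↦ (z₀ + t • h) i) (h i) 0 := by
    simpa using ((hasDerivAt_id (0 : ℝ)).mul_const (h i)).const_add (z₀ i)
  have hz0 (i : Fin 6) : (z₀ + (0 : ℝ) • h) i = z₀ i := by simp
  -- the requested tangential force along the line, and its slope
  have hft0 : tangentialForce p k α_d ((z₀ + (0 : ℝ) • h) 1) ((z₀ + (0 : ℝ) • h) 4) = f₀ := by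
    rw [hz0, hz0, e1, e4, tangentialForce_self, hf₀]
  have hft : HasDerivAt
      (fun t : ℝ ↦ tangentialForce p k α_d ((z₀ + t • h) 1) ((z₀ + t • h) 4))
      (-(k.kp_α + a * p.g) * h 1 - k.kv_α * h 4) 0 := by
    have := ((((hz 1).const_sub α_d).const_mul k.kp_α).sub ((hz 4).const_mul k.kv_α)).add
      ((hz 1).cos.const_mul (p.apparentMass * p.L * p.g))
    refine this.congr_deriv ?_
    rw [hz0, e1, ha]
    ring
  have hθ : HasDerivAt
      (fun t : ℝ ↦ thetaD p k (tangentialForce p k α_d ((z₀ + t • h) 1) ((z₀ + t • h) 4)))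
      (θ' * (-(k.kp_α + a * p.g) * h 1 - k.kv_α * h 4)) 0 := by
    have h1 := ((contDiffAt_thetaD p k hf).differentiableAt one_ne_zero).hasDerivAt
    rw [← hθ'] at h1
    exact HasDerivAt.comp_of_eq (h₂ := thetaD p k) 0 h1 hft hft0.symm
  have hu : HasDerivAt
      (fun t : ℝ ↦ normalizedThrust p k
        (tangentialForce p k α_d ((z₀ + t • h) 1) ((z₀ + t • h) 4)))
      (deriv (normalizedThrust p k) f₀ *
        (-(k.kp_α + a * p.g) * h 1 - k.kv_α * h 4)) 0 :=
    HasDerivAt.comp_of_eq 0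
      ((contDiffAt_normalizedThrust p k hf).differentiableAt one_ne_zero).hasDerivAt hft hft0.symm
  have hsin : HasDerivAt (fun t : ℝ ↦ p.apparentMass * p.L * Real.sin ((z₀ + t • h) 1)) _ 0 :=
    (hz 1).sin.const_mul _
  rw [attitudeError_apply] at he
  refine ⟨(hφ 0).unique (hz 3), (hφ 1).unique (hz 4), (hφ 2).unique (hz 5), ?_, ?_, ?_⟩
  · have hl := ((hφ 3).const_mul p.totalMass).sub (hsin.mul (hφ 4))
    have hr := ((((hz 0).const_sub x_d).const_mul k.kp_x).sub ((hz 3).const_mul k.kv_x)).add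
      ((((hz 4).const_mul (p.apparentMass * p.L)).mul (hz 1).cos).mul (hz 4))
    have := (hl.congr_of_eventuallyEq
      (Eventually.of_forall fun t ↦ (rel t).2.2.2.1.1.symm)).unique hr
    simp only [hφ0, hz0, Pi.mul_apply, e1, e4] at this
    rw [ha]
    linarith
  · have hl := ((hφ 4).const_mul (p.inertia * p.L)).sub (hsin.mul (hφ 3))
    have hr := (hu.mul ((hz 2).sub (hz 1)).sin).sub
      ((hz 1).cos.const_mul (p.apparentMass * p.L * p.g))
    have := (hl.congr_of_eventuallyEq
      (Eventually.of_forall fun t ↦ (rel t).2.2.2.1.2.symm)).unique hr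
    have hcomp := deriv_normalizedThrust_add p k hf
    rw [← hθ'] at hcomp
    rw [hft0] at this
    simp only [hφ0, hz0, Pi.sub_apply, e1, e2, add_sub_cancel_left] at this
    rw [he, ha]
    rw [ha] at this
    linear_combination this + (-(k.kp_α + p.apparentMass * p.L * Real.sin α_d * p.g) * h 1 -
      k.kv_α * h 4) * hcomp
  · have hl := (hφ 5).const_mul p.I_a
    have hr := ((((hz 1).add hθ).sub (hz 2)).const_mul kp_β).sub ((hz 5).const_mul kv_β)
    have := (hl.congr_of_eventuallyEq
      (Eventually.of_forall fun t ↦ (rel t).2.2.2.2.symm)).unique hr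
    rw [this, he]
    ring

end VectorField

end UavUgv

end

theorem theorem1 (p : UavUgv.Plant) (k : UavUgv.Gains) (x_d α_d : ℝ)
    (hα : α_d ∈ Set.Ioo p.alphaMin p.alphaMax) :
    ∃ K > 0, ∀ kv_β kp_β : ℝ, K ≤ kv_β → K * kv_β ≤ kp_β →
      IsAsymptoticallyStable (UavUgv.closedLoop p k kp_β kv_β x_d α_d)
        (UavUgv.equilibriumState p k x_d α_d) := by
  obtain ⟨f₀, hf₀⟩ : ∃ f₀, f₀ = p.apparentMass * p.L * p.g * Real.cos α_d := ⟨_, rfl⟩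
  obtain ⟨θ', hθ'⟩ : ∃ θ', θ' = deriv (UavUgv.thetaD p k) f₀ := ⟨_, rfl⟩
  obtain ⟨a, ha⟩ : ∃ a, a = p.apparentMass * p.L * Real.sin α_d := ⟨_, rfl⟩
  obtain ⟨K, hK, hB⟩ := exists_lyapunovForm p.totalMass_pos (mul_pos p.inertia_pos p.L_pos)
    (ha ▸ p.sq_lt_totalMass_mul_inertia α_d) k.kp_x_pos k.kv_x_pos k.kp_α_pos k.kv_α_pos p.I_a_pos
    (UavUgv.normalizedThrust p k f₀ * Real.cos (UavUgv.thetaD p k f₀))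
    (1 - θ' * (k.kp_α + a * p.g)) (-θ' * k.kv_α)
  refine ⟨K, hK, fun kv kp hkv hkp ↦ ?_⟩
  obtain ⟨B, hpos, hneg⟩ := hB kv kp hkv hkp
  have hC : ContDiffAt ℝ 1 (UavUgv.closedLoopField p k kp kv x_d α_d)
      (UavUgv.equilibriumState p k x_d α_d) := by
    refine UavUgv.contDiffAt_closedLoopField p k kp kv x_d ?_
    change |UavUgv.tangentialForce p k α_d α_d 0| < _
    rw [UavUgv.tangentialForce_self]
    exact p.abs_gravity_lt hα
  have hA := (hC.differentiableAt one_ne_zero).hasFDerivAt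
  refine isAsymptoticallyStable_of_quadratic (UavUgv.closedLoop_iff p k kp kv x_d α_d) hC hA
    (UavUgv.closedLoopField_equilibriumState p k kp kv x_d hα) B hpos fun h hh ↦ ?_
  obtain ⟨h0, h1, h2, h3, h4, h5⟩ :=
    UavUgv.linearization_closedLoopField p k kp kv x_d hα hA hf₀ hθ' ha h rfl
  exact hneg h hh _ h0 h1 h2 h3 h4 h5
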